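/- Theorem (Schramm). Let $n\ge 1$ and let $W\subset\mathbb R^n$ be a set of constant width, that is, a convex body (a compact convex set with non-empty interior) for which there is $w\in\mathbb R$ with $h_W(u)+h_W(-u)=w$ for every unit vector $u\in\mathbb R^n$, where $h_W(x)=\max\{\langle x,k\rangle : k\in W\}$ is the support function of $W$. Let the illumination number $i(W)$ be the minimum number of translates of the interior of $W$ whose union contains $W$. Then $i(W)$ is finite and $$i(W)\le 5n\sqrt n\,(4+\ln n)\left(\tfrac32\right)^{n/2}.$$ -/

import Mathlib

open scoped Pointwise

noncomputable section

namespace Illumination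

/-- Euclidean space of dimension `n`. -/
abbrev E (n : ℕ) : Type := EuclideanSpace ℝ (Fin n)

/-- The translative covering number of `K` by `L`: the minimum number of translates of `L`
whose union contains `K`; it is `⊤` if finitely many translates never suffice. -/
def coveringNumber {n : ℕ} (K L : Set (E n)) : ℕ∞ :=
  ⨅ (T : Set (E n)) (_ : K ⊆ ⋃ t ∈ T, t +ᵥ L), T.encard

/-- The illumination number of `K`: the minimum number of translates of the interior of `K`
that cover `K`. -/
def illuminationNumber {n : ℕ} (K : Set (E n)) : ℕ∞ :=
  coveringNumber K (interior K)

/-- A convex body: a compact convex set with non-empty interior. -/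
structure IsConvexBody {n : ℕ} (K : Set (E n)) : Prop where
  isCompact : IsCompact K
  convex : Convex ℝ K
  interior_nonempty : (interior K).Nonempty

/-- The support function of `K` (used for non-empty bounded `K` only). -/
def supportFunction {n : ℕ} (K : Set (E n)) (x : E n) : ℝ :=
  sSup ((fun k : E n => inner ℝ x k) '' K)

/-- The width of `K` in direction `u`: for a unit vector `u`, the distance of the two
hyperplanes orthogonal to `u` that support `K`. -/
def width {n : ℕ} (K : Set (E n)) (u : E n) : ℝ :=
  supportFunction K u + supportFunction K (-u)

/-- A set of constant width: a convex body that has the same width in all directions. -/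
structure IsConstantWidth {n : ℕ} (K : Set (E n)) : Prop where
  isConvexBody : IsConvexBody K
  exists_width_eq : ∃ w : ℝ, ∀ u : E n, ‖u‖ = 1 → width K u = w

end Illumination

end

namespace Illumination

/-! A direction y illuminates x once it makes an obtuse angle with every outer normal at x, and
finitely many directions serving all of W give as many translates of its interior
(`illuminationNumber_le_card`). In constant width w, each unit normal u at x yields a diameter: x -
w u lies in W. As W has diameter at most w, the normals at all points within w/(25n) of a common
centre form a set X of diameter D ≤ 1 + 2/(25n) (`norm_sub_le_of_mem_outerNormals`), and X lies in a
cap of angle about 45° (`exists_center`).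

The cone polar to that cap has sine about 1/√2 and would only yield a factor 2^(n/2). The gain comes
from a wider circular cone, of sine about √(2/3): for y in it, y or its mirror image in the axis
lies in the polar of X (`mem_strictPolar_or_reflection_mem`). So the polar fills half of that cone,
hence a share p of the unit ball of order (2/3)^(n/2)/√n. A net of at most exp(n(4 + ln n)) centres
suffices, and greedy choice hits all their polars with n(4 + ln n)/p + 1 points (`exists_hitting`).
-/

/-- The unit outer normals of `W` at `x`. -/
def outerNormals {n : ℕ} (W : Set (E n)) (x : E n) : Set (E n) :=
  {u | ‖u‖ = 1 ∧ ∀ k ∈ W, inner ℝ u k ≤ inner ℝ u x}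

/-! ### Supporting hyperplanes and diameters in constant width. -/

section Support

variable {n : ℕ} {W : Set (E n)}

lemma IsConvexBody.nonempty (hW : IsConvexBody W) : W.Nonempty :=
  hW.interior_nonempty.mono interior_subset

lemma inner_le_supportFunction (hW : IsConvexBody W) (u : E n) {k : E n} (hk : k ∈ W) :
    inner ℝ u k ≤ supportFunction W u := by
  have hc : ContinuousOn (fun k : E n => inner ℝ u k) W := by fun_prop
  exact le_csSup (hW.isCompact.image_of_continuousOn hc).bddAbove ⟨k, hk, rfl⟩

lemma exists_inner_eq_supportFunction (hW : IsConvexBody W) (u : E n) :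
    ∃ k ∈ W, inner ℝ u k = supportFunction W u := by
  have hc : ContinuousOn (fun k : E n => inner ℝ u k) W := by fun_prop
  have := (hW.isCompact.image_of_continuousOn hc).sSup_mem (hW.nonempty.image _)
  obtain ⟨k, hk, h⟩ := this
  exact ⟨k, hk, h⟩

lemma supportFunction_eq_of_mem_outerNormals (hW : IsConvexBody W) {x u : E n} (hx : x ∈ W)
    (hu : u ∈ outerNormals W x) : supportFunction W u = inner ℝ u x := by
  refine le_antisymm ?_ (inner_le_supportFunction hW u hx)
  obtain ⟨k, hk, h⟩ := exists_inner_eq_supportFunction hW u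
  rw [← h]
  exact hu.2 k hk

lemma norm_sub_le_of_width (hW : IsConvexBody W) {w : ℝ}
    (hw : ∀ u : E n, ‖u‖ = 1 → width W u = w) {a b : E n} (ha : a ∈ W) (hb : b ∈ W)
    (hab : a ≠ b) : ‖a - b‖ ≤ w := by
  have hpos : 0 < ‖a - b‖ := norm_pos_iff.2 (sub_ne_zero.2 hab)
  set u : E n := ‖a - b‖⁻¹ • (a - b) with hu
  have hu1 : ‖u‖ = 1 := by
    rw [hu, norm_smul, norm_inv, norm_norm, inv_mul_cancel₀ hpos.ne']
  have h1 := inner_le_supportFunction hW u ha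
  have h2 := inner_le_supportFunction hW (-u) hb
  have h3 := hw u hu1
  have h4 : inner ℝ u (a - b) = ‖a - b‖ := by
    rw [hu, real_inner_smul_left, real_inner_self_eq_norm_sq]
    field_simp
  rw [inner_sub_right] at h4
  rw [inner_neg_left] at h2
  unfold width at h3
  linarith

lemma width_pos (hn : 1 ≤ n) (hW : IsConvexBody W) {w : ℝ}
    (hw : ∀ u : E n, ‖u‖ = 1 → width W u = w) : 0 < w := by
  have : Nonempty (Fin n) := ⟨⟨0, hn⟩⟩
  have : Nontrivial (E n) := inferInstance
  obtain ⟨a, ha⟩ := hW.interior_nonempty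
  obtain ⟨b, hb, hab⟩ : ∃ b ∈ interior W, b ≠ a := by
    by_contra! h
    have h1 : interior W = {a} := Set.eq_singleton_iff_unique_mem.2 ⟨ha, h⟩
    exact not_isOpen_singleton a (h1 ▸ isOpen_interior)
  exact (norm_pos_iff.2 (sub_ne_zero.2 hab)).trans_le
    (norm_sub_le_of_width hW hw (interior_subset hb) (interior_subset ha) hab)

/-- In a body of constant width, every normal at a point `x` is a diameter issuing from `x`. -/
lemma sub_smul_mem_of_mem_outerNormals (hW : IsConvexBody W) {w : ℝ}
    (hw : ∀ u : E n, ‖u‖ = 1 → width W u = w) (hw0 : 0 < w) {x u : E n} (hx : x ∈ W)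
    (hu : u ∈ outerNormals W x) : x - w • u ∈ W := by
  obtain ⟨z, hz, h⟩ := exists_inner_eq_supportFunction hW (-u)
  have h1 := supportFunction_eq_of_mem_outerNormals hW hx hu
  have h2 := hw u hu.1
  unfold width at h2
  have h3 : inner ℝ u (x - z) = w := by
    rw [inner_neg_left] at h
    rw [inner_sub_right]
    linarith
  have hxz : x ≠ z := by
    rintro rfl
    simp at h3
    linarith
  have h4 : ‖x - z‖ ≤ w := norm_sub_le_of_width hW hw hx hz hxz
  -- Equality case of Cauchy-Schwarz: the square is ‖x - z‖² - 2w² + w², and ‖x - z‖ ≤ w.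
  have h5 : ‖x - z - w • u‖ ^ 2 ≤ 0 := by
    rw [norm_sub_sq_real, real_inner_smul_right, real_inner_comm, h3, norm_smul, hu.1,
      Real.norm_of_nonneg hw0.le]
    nlinarith [norm_nonneg (x - z)]
  have h6 : x - z - w • u = 0 := norm_eq_zero.1 (pow_eq_zero_iff two_ne_zero |>.1
    (le_antisymm h5 (sq_nonneg _)))
  have h7 : x - w • u = z := by
    rw [sub_right_comm] at h6
    exact sub_eq_zero.1 h6
  rwa [h7]

end Support

/-! ### From illuminating directions to translates of the interior. -/

section Directions

variable {n : ℕ} {W : Set (E n)}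

/-- If the ray missed the interior, a hyperplane separating the two would support W at x, and its
normal would be an outer normal whose product with y is non-negative. -/
lemma exists_add_smul_mem_interior (hW : IsConvexBody W) {x y : E n} (hx : x ∈ W)
    (hy : ∀ u ∈ outerNormals W x, inner ℝ u y < 0) :
    ∃ ε : ℝ, 0 < ε ∧ x + ε • y ∈ interior W := by
  by_contra! hcon
  have hray : Convex ℝ ((fun ε : ℝ => x + ε • y) '' Set.Ioi 0) := by
    rintro _ ⟨s, hs, rfl⟩ _ ⟨t, ht, rfl⟩ a b ha hb hab
    refine ⟨a * s + b * t, ?_, ?_⟩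
    · have := (convex_Ioi (0 : ℝ)) hs ht ha hb hab
      simpa using this
    · have : x = a • x + b • x := by rw [← add_smul, hab, one_smul]
      simp only [smul_add, smul_smul, add_smul]
      nth_rewrite 1 [this]
      abel
  have hdisj : Disjoint (interior W) ((fun ε : ℝ => x + ε • y) '' Set.Ioi 0) := by
    rw [Set.disjoint_right]
    rintro _ ⟨s, hs, rfl⟩
    exact hcon s hs
  obtain ⟨f, s, hf1, hf2⟩ := geometric_hahn_banach_open hW.convex.interior isOpen_interior hray hdisj
  have hcl : ∀ k ∈ W, f k ≤ s := by
    intro k hk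
    have : k ∈ closure (interior W) := by
      rw [hW.convex.closure_interior_eq_closure_of_nonempty_interior hW.interior_nonempty]
      exact subset_closure hk
    have h2 : closure (interior W) ⊆ {k | f k ≤ s} :=
      closure_minimal (fun a ha => (hf1 a ha).le) (isClosed_le f.continuous continuous_const)
    exact h2 this
  have hfy : ∀ ε : ℝ, 0 < ε → s ≤ f x + ε * f y := by
    intro ε hε
    have := hf2 _ ⟨ε, hε, rfl⟩
    simpa using this
  have hsx : s ≤ f x := by
    have ht : Filter.Tendsto (fun ε : ℝ => f x + ε * f y) (nhdsWithin 0 (Set.Ioi 0))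
        (nhds (f x + 0 * f y)) :=
      ((by fun_prop : Continuous fun ε : ℝ => f x + ε * f y).tendsto 0).mono_left
        nhdsWithin_le_nhds
    have := ge_of_tendsto ht (by filter_upwards [self_mem_nhdsWithin] with ε hε using hfy ε hε)
    simpa using this
  set v : E n := (InnerProductSpace.toDual ℝ (E n)).symm f with hv
  have hvf : ∀ z, inner ℝ v z = f z := fun z => by
    rw [hv, InnerProductSpace.toDual_symm_apply]
  obtain ⟨a, ha⟩ := hW.interior_nonempty
  have hv0 : v ≠ 0 := by
    intro h0
    have h1 := hf1 a ha
    have h2 := hvf a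
    have h3 := hvf x
    rw [h0, inner_zero_left] at h2 h3
    linarith
  have hvn : 0 < ‖v‖⁻¹ := inv_pos.2 (norm_pos_iff.2 hv0)
  have hu : ‖v‖⁻¹ • v ∈ outerNormals W x := by
    refine ⟨by rw [norm_smul, norm_inv, norm_norm, inv_mul_cancel₀ (norm_ne_zero_iff.2 hv0)], ?_⟩
    intro k hk
    rw [real_inner_smul_left, real_inner_smul_left, hvf, hvf]
    exact mul_le_mul_of_nonneg_left ((hcl k hk).trans hsx) hvn.le
  have h1 := hy _ hu
  rw [real_inner_smul_left, hvf] at h1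
  have h2 : f y < 0 := by
    by_contra! h
    exact absurd h1 (not_lt.2 (mul_nonneg hvn.le h))
  have h3 := hfy 1 one_pos
  have h4 := hcl x hx
  linarith

/-- Finitely many directions that illuminate `W` give as many translates of its interior. -/
lemma illuminationNumber_le_card (hW : IsConvexBody W) (Y : Finset (E n))
    (hY : ∀ x ∈ W, ∃ y ∈ Y, ∀ u ∈ outerNormals W x, inner ℝ u y < 0) :
    illuminationNumber W ≤ (Y.card : ℕ∞) := by
  classical
  let V : ℕ → Set (E n) := fun k => {x | ∃ y ∈ Y, ∃ j ≤ k, x + ((j : ℝ) + 1)⁻¹ • y ∈ interior W}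
  have hmove : ∀ x ∈ W, ∀ y : E n, ∀ s t : ℝ, 0 < t → t ≤ s → x + s • y ∈ interior W →
      x + t • y ∈ interior W := by
    intro x hx y s t ht hts hs
    have hs0 : 0 < s := ht.trans_le hts
    have h := hW.convex.combo_interior_self_mem_interior hs hx (a := t / s) (b := 1 - t / s)
      (by positivity) (by rw [sub_nonneg, div_le_one hs0]; exact hts) (by ring)
    convert h using 1
    rw [smul_add, smul_smul, div_mul_cancel₀ _ hs0.ne', sub_smul, one_smul]
    abel
  have hVo : ∀ k, IsOpen (V k) := by
    intro k
    have : V k = ⋃ y ∈ Y, ⋃ j ∈ Set.Iic k,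
        (fun x : E n => x + ((j : ℝ) + 1)⁻¹ • y) ⁻¹' interior W := by
      ext x; simp [V]
    rw [this]
    exact isOpen_biUnion fun y _ => isOpen_biUnion fun j _ =>
      isOpen_interior.preimage (by fun_prop)
  have hVm : Monotone V := by
    rintro k l hkl x ⟨y, hy, j, hj, h⟩
    exact ⟨y, hy, j, hj.trans hkl, h⟩
  have hcov : W ⊆ ⋃ k, V k := by
    intro x hx
    obtain ⟨y, hy, h⟩ := hY x hx
    obtain ⟨ε, hε, h1⟩ := exists_add_smul_mem_interior hW hx h
    obtain ⟨k, hk⟩ := exists_nat_one_div_lt hε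
    rw [one_div] at hk
    exact Set.mem_iUnion.2 ⟨k, y, hy, k, le_rfl, hmove x hx y ε _ (by positivity) hk.le h1⟩
  -- By `hmove`, shortening a step keeps it in the interior, so the single length 1/(k+1) serves
  -- every point of W.
  obtain ⟨k, hk⟩ := hW.isCompact.elim_directed_cover V hVo hcov hVm.directed_le
  let T : Finset (E n) := Y.image fun y => -(((k : ℝ) + 1)⁻¹ • y)
  have hT : W ⊆ ⋃ t ∈ (T : Set (E n)), t +ᵥ interior W := by
    intro x hx
    obtain ⟨y, hy, j, hj, h⟩ := hk hx
    have h1 := hmove x hx y _ (((k : ℝ) + 1)⁻¹) (by positivity) (by gcongr) h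
    refine Set.mem_biUnion (Finset.mem_coe.2 (Finset.mem_image_of_mem _ hy)) ?_
    refine ⟨_, h1, ?_⟩
    simp
  calc illuminationNumber W ≤ (T : Set (E n)).encard := iInf₂_le (f := fun (T : Set (E n)) (_ : W ⊆ ⋃ t ∈ T, t +ᵥ interior W) => T.encard) _ hT
    _ = (T.card : ℕ∞) := Set.encard_coe_eq_coe_finsetCard T
    _ ≤ (Y.card : ℕ∞) := by exact_mod_cast Finset.card_image_le

end Directions

end Illumination

namespace Illumination

/-! ### Nets of controlled size by volume packing. -/

section Net

open MeasureTheory Metric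

lemma card_le_of_separated {n : ℕ} (S : Finset (E n)) (x₀ : E n) {r R : ℝ} (hr : 0 < r)
    (hR : 0 ≤ R) (hS : ∀ s ∈ S, dist s x₀ ≤ R) (hsep : ∀ s ∈ S, ∀ t ∈ S, s ≠ t → r < dist s t) :
    (S.card : ℝ) ≤ (1 + 2 * R / r) ^ n := by
  have D : Set.Pairwise (S : Set (E n)) (Function.onFun Disjoint fun c => ball (c : E n) (r / 2)) := by
    rintro c hc d hd hcd
    apply ball_disjoint_ball
    linarith [hsep c hc d hd hcd]
  have hsub : (⋃ c ∈ S, ball (c : E n) (r / 2)) ⊆ ball x₀ (r / 2 + R) :=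
    Set.iUnion₂_subset fun x hx => ball_subset_ball' (by linarith [hS x hx])
  have I := measure_mono (μ := (volume : Measure (E n))) hsub
  rw [measure_biUnion_finset D fun c _ => measurableSet_ball] at I
  simp only [Measure.addHaar_ball_of_pos volume _ (half_pos hr),
    Measure.addHaar_ball_of_pos volume x₀ (by positivity : 0 < r / 2 + R), Finset.sum_const,
    nsmul_eq_mul, ← mul_assoc, finrank_euclideanSpace_fin] at I
  have J := (ENNReal.mul_le_mul_iff_left (measure_ball_pos _ _ zero_lt_one).ne'
    measure_ball_lt_top.ne).1 I
  have K : (S.card : ℝ) * (r / 2) ^ n ≤ (r / 2 + R) ^ n := by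
    have := ENNReal.toReal_le_of_le_ofReal (by positivity) J
    simpa [ENNReal.toReal_mul, ENNReal.toReal_ofReal (by positivity : 0 ≤ (r / 2) ^ n)] using this
  have h : 1 + 2 * R / r = (r / 2 + R) / (r / 2) := by field_simp
  rw [h, div_pow, le_div_iff₀ (by positivity)]
  exact K

lemma exists_net {n : ℕ} {W : Set (E n)} (x₀ : E n) {r R : ℝ} (hr : 0 < r)
    (hR : 0 ≤ R) (hW : W ⊆ closedBall x₀ R) :
    ∃ S : Finset (E n), (∀ x ∈ W, ∃ s ∈ S, dist x s ≤ r) ∧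
      (S.card : ℝ) ≤ (1 + 2 * R / r) ^ n := by
  classical
  let P : ℕ → Prop := fun k => ∃ S : Finset (E n), (S : Set (E n)) ⊆ W ∧
    (∀ s ∈ S, ∀ t ∈ S, s ≠ t → r < dist s t) ∧ S.card = k
  have hbound : ∀ k, P k → (k : ℝ) ≤ (1 + 2 * R / r) ^ n := by
    rintro k ⟨S, hSW, hsep, rfl⟩
    exact card_le_of_separated S x₀ hr hR (fun s hs => hW (hSW hs)) hsep
  have hP0 : P 0 := ⟨∅, by simp, by simp, rfl⟩
  -- The packing bound caps the size of separated subsets, so a largest one exists; a point of W far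
  -- from it could be added.
  have hk : P (Nat.findGreatest P ⌊(1 + 2 * R / r) ^ n⌋₊) :=
    Nat.findGreatest_spec (Nat.zero_le _) hP0
  obtain ⟨S, hSW, hsep, hcard⟩ := hk
  refine ⟨S, ?_, card_le_of_separated S x₀ hr hR (fun s hs => hW (hSW hs)) hsep⟩
  intro x hx
  by_contra! hfar
  have hxS : x ∉ S := fun h => by
    have := hfar x h
    rw [dist_self] at this
    linarith
  have hP : P (S.card + 1) := by
    refine ⟨insert x S, ?_, ?_, Finset.card_insert_of_notMem hxS⟩
    · rw [Finset.coe_insert]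
      exact Set.insert_subset hx hSW
    · intro s hs t ht hst
      rcases Finset.mem_insert.1 hs with hs | hs <;> rcases Finset.mem_insert.1 ht with ht | ht
      · exact absurd (hs.trans ht.symm) hst
      · exact hs ▸ hfar t ht
      · rw [dist_comm]
        exact ht ▸ hfar s hs
      · exact hsep s hs t ht hst
  have h1 := Nat.le_findGreatest (Nat.le_floor (hbound _ hP)) hP
  omega

end Net

/-! ### Greedy hitting of sets of large measure. -/

section Greedy

open MeasureTheory

variable {Ω ι : Type*} [MeasurableSpace Ω] (μ : Measure Ω) [IsProbabilityMeasure μ]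
  {A : ι → Set Ω} {p : ℝ}

/-- A random point lies in at least p|J| of the sets on average, so some point does. -/
lemma exists_card_mem_ge [DecidableEq ι] (hA : ∀ i, MeasurableSet (A i))
    (hp : ∀ i, p ≤ μ.real (A i)) (J : Finset ι) :
    ∃ y, ∃ J' ⊆ J, (∀ i ∈ J, i ∉ J' → y ∈ A i) ∧ (J'.card : ℝ) ≤ (1 - p) * J.card := by
  classical
  have hint : ∀ i ∈ J, Integrable ((A i).indicator fun _ => (1 : ℝ)) μ := fun i _ =>
    (integrable_const 1).indicator (hA i)
  obtain ⟨y, hy⟩ := exists_integral_le (μ := μ) (integrable_finsetSum J hint)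
  rw [integral_finsetSum J hint] at hy
  have h1 : ∀ i, ∫ a, (A i).indicator (fun _ => (1 : ℝ)) a ∂μ = μ.real (A i) := fun i => by
    rw [integral_indicator_const _ (hA i)]; simp
  simp only [h1] at hy
  have h2 : p * J.card ≤ ∑ i ∈ J, μ.real (A i) := by
    have := Finset.sum_le_sum (s := J) fun i _ => hp i
    simpa [mul_comm] using this
  have h3 : ∑ i ∈ J, (A i).indicator (fun _ => (1 : ℝ)) y = (J.filter fun i => y ∈ A i).card := by
    rw [Finset.card_filter]
    push_cast
    exact Finset.sum_congr rfl fun i _ => by simp [Set.indicator]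
  have h4 := Finset.card_filter_add_card_filter_not (s := J) (p := fun i => y ∈ A i)
  refine ⟨y, J.filter fun i => y ∉ A i, Finset.filter_subset _ _, ?_, ?_⟩
  · intro i hi h
    simpa [hi] using h
  · have h5 : ((J.filter fun i => y ∈ A i).card : ℝ) + (J.filter fun i => y ∉ A i).card = J.card := by
      exact_mod_cast h4
    linarith

lemma exists_hitting_of_pow [DecidableEq ι] (hA : ∀ i, MeasurableSet (A i))
    (hp : ∀ i, p ≤ μ.real (A i)) (hp1 : p ≤ 1) (J : Finset ι) (k : ℕ) :
    ∃ Y : Finset Ω, Y.card ≤ k ∧ ∃ J' ⊆ J, (∀ i ∈ J, i ∉ J' → ∃ y ∈ Y, y ∈ A i) ∧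
      (J'.card : ℝ) ≤ (1 - p) ^ k * J.card := by
  classical
  induction k with
  | zero => exact ⟨∅, by simp, J, subset_rfl, fun i hi h => absurd hi h, by simp⟩
  | succ k ih =>
    obtain ⟨Y, hY, J', hJ', hhit, hcard⟩ := ih
    obtain ⟨y, J'', hJ'', hhit', hcard'⟩ := exists_card_mem_ge μ hA hp J'
    refine ⟨insert y Y, (Finset.card_insert_le _ _).trans (by omega), J'', hJ''.trans hJ', ?_, ?_⟩
    · intro i hi h
      by_cases h' : i ∈ J'
      · exact ⟨y, Finset.mem_insert_self _ _, hhit' i h' h⟩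
      · obtain ⟨z, hz, hz'⟩ := hhit i hi h'
        exact ⟨z, Finset.mem_insert_of_mem hz, hz'⟩
    · calc (J''.card : ℝ) ≤ (1 - p) * J'.card := hcard'
        _ ≤ (1 - p) * ((1 - p) ^ k * J.card) :=
          mul_le_mul_of_nonneg_left hcard (by linarith)
        _ = (1 - p) ^ (k + 1) * J.card := by ring

/-- Sets of measure at least `p` in a probability space can be hit by few points. -/
lemma exists_hitting [DecidableEq ι] (hA : ∀ i, MeasurableSet (A i))
    (hp : ∀ i, p ≤ μ.real (A i)) (hp0 : 0 < p) (hp1 : p ≤ 1) (J : Finset ι) {L : ℝ} (hL : 0 ≤ L)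
    (hJ : (J.card : ℝ) ≤ Real.exp L) :
    ∃ Y : Finset Ω, (Y.card : ℝ) ≤ L / p + 1 ∧ ∀ i ∈ J, ∃ y ∈ Y, y ∈ A i := by
  -- The extra 1 makes pk > L strict, so fewer than one set stays unhit.
  obtain ⟨Y, hY, J', hJ', hhit, hcard⟩ := exists_hitting_of_pow μ hA hp hp1 J (⌊L / p⌋₊ + 1)
  refine ⟨Y, ?_, fun i hi => hhit i hi ?_⟩
  · have h1 : (Y.card : ℝ) ≤ ⌊L / p⌋₊ + 1 := by exact_mod_cast hY
    linarith [Nat.floor_le (by positivity : 0 ≤ L / p)]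
  · have h2 : (1 - p) ^ (⌊L / p⌋₊ + 1) ≤ Real.exp (-p * (⌊L / p⌋₊ + 1)) := by
      have h := Real.add_one_le_exp (-p)
      calc (1 - p) ^ (⌊L / p⌋₊ + 1) ≤ Real.exp (-p) ^ (⌊L / p⌋₊ + 1) :=
            pow_le_pow_left₀ (by linarith) (by linarith) _
        _ = _ := by rw [← Real.exp_nat_mul]; push_cast; ring_nf
    have h3 : L < p * (⌊L / p⌋₊ + 1) := by
      have := Nat.lt_floor_add_one (L / p)
      rw [div_lt_iff₀ hp0] at this
      linarith
    have h4 : (J'.card : ℝ) < 1 := by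
      calc (J'.card : ℝ) ≤ (1 - p) ^ (⌊L / p⌋₊ + 1) * J.card := hcard
        _ ≤ Real.exp (-p * (⌊L / p⌋₊ + 1)) * Real.exp L := by gcongr
        _ = Real.exp (L - p * (⌊L / p⌋₊ + 1)) := by rw [← Real.exp_add]; ring_nf
        _ < Real.exp 0 := Real.exp_lt_exp.2 (by linarith)
        _ = 1 := Real.exp_zero
    have h5 : J' = ∅ := by
      rw [← Finset.card_eq_zero]
      have : J'.card < 1 := by exact_mod_cast h4
      omega
    simp [h5]

end Greedy

end Illumination

namespace Illumination

/-! ### Volume of a circular cone inside the unit ball; h and r are the cosine and sine of its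
half-angle. -/

section ConeVolume

open MeasureTheory Metric Set

lemma integral_mul_sqrt_one_sub_sq_pow (m : ℕ) {h r : ℝ} (h0 : 0 < h) (h1 : h ≤ 1) (hr : 0 ≤ r)
    (hhr : h ^ 2 + r ^ 2 = 1) :
    ∫ t in h..1, t * √(1 - t ^ 2) ^ m = r ^ (m + 2) / (m + 2) := by
  have hder : ∀ t ∈ Ioo h 1, HasDerivAt (fun t : ℝ => -(√(1 - t ^ 2) ^ (m + 2) / (m + 2)))
      (t * √(1 - t ^ 2) ^ m) t := by
    intro t ht
    have hpos : 0 < 1 - t ^ 2 := by nlinarith [ht.1, ht.2]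
    have hs : 0 < √(1 - t ^ 2) := Real.sqrt_pos.2 hpos
    have hd : HasDerivAt (fun t : ℝ => 1 - t ^ 2) (-(2 * t)) t := by
      simpa using ((hasDerivAt_pow 2 t).const_sub 1)
    refine HasDerivAt.congr_deriv
      (((hd.sqrt hpos.ne').pow (m + 2)).div_const ((m : ℝ) + 2)).neg ?_
    have hm : (m : ℝ) + 2 ≠ 0 := by positivity
    push_cast
    rw [pow_succ]
    field_simp
  rw [intervalIntegral.integral_eq_sub_of_hasDerivAt_of_le h1 (by fun_prop) hder
    (Continuous.intervalIntegrable (by fun_prop) _ _)]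
  have e : 1 - h ^ 2 = r ^ 2 := by linarith
  simp only [e, Real.sqrt_sq hr]
  simp

lemma integral_mul_div_pow (m : ℕ) {h r : ℝ} (h0 : 0 < h) :
    ∫ t in (0 : ℝ)..h, (r * t / h) ^ m = r ^ m * (h / (m + 1)) := by
  have : ∀ t : ℝ, (r * t / h) ^ m = (r / h) ^ m * t ^ m := fun t => by
    rw [← mul_pow]; ring
  simp only [this, intervalIntegral.integral_const_mul, integral_pow]
  have hm : (m : ℝ) + 1 ≠ 0 := by positivity
  rw [div_pow]
  field_simp
  simp [pow_succ, mul_assoc]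

/-- The circular cone `h ‖z‖ < r t`, cut by the open unit ball. -/
def coneSector (m : ℕ) (h r : ℝ) : Set (ℝ × E m) :=
  {q | 0 < q.1 ∧ h * ‖q.2‖ < r * q.1 ∧ q.1 ^ 2 + ‖q.2‖ ^ 2 < 1}

lemma isOpen_coneSector (m : ℕ) (h r : ℝ) : IsOpen (coneSector m h r) := by
  simp only [coneSector, ofPred_and]
  refine (isOpen_lt ?_ ?_).inter ((isOpen_lt ?_ ?_).inter (isOpen_lt ?_ ?_)) <;> fun_prop

lemma le_volume_coneSector (m : ℕ) {h r : ℝ} (h0 : 0 < h) (hr : 0 < r)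
    (hhr : h ^ 2 + r ^ 2 = 1) :
    ENNReal.ofReal (r ^ m * (h / (m + 1)) + r ^ (m + 2) / (m + 2)) * volume (ball (0 : E m) 1) ≤
      volume (coneSector m h r) := by
  have h1 : h < 1 := by nlinarith
  have hball : ∀ ρ : ℝ, 0 < ρ → volume (ball (0 : E m) ρ) =
      ENNReal.ofReal (ρ ^ m) * volume (ball (0 : E m) 1) := fun ρ hρ => by
    rw [Measure.addHaar_ball_of_pos volume _ hρ, finrank_euclideanSpace_fin]
  have hsl1 : ∀ t ∈ Ioo 0 h, ENNReal.ofReal ((r * t / h) ^ m) * volume (ball (0 : E m) 1) ≤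
      volume (Prod.mk t ⁻¹' coneSector m h r) := by
    intro t ht
    have ht0 := ht.1
    rw [← hball _ (by positivity)]
    refine measure_mono fun z hz => ?_
    rw [mem_ball_zero_iff, lt_div_iff₀ h0] at hz
    have hz' : h * ‖z‖ < h * r := by nlinarith [ht.2]
    have hz2 : ‖z‖ < r := lt_of_mul_lt_mul_left hz' h0.le
    refine ⟨ht0, by dsimp only; linarith, ?_⟩
    dsimp only
    nlinarith [norm_nonneg z, ht.2]
  have hsl2 : ∀ t ∈ Ioo h 1, ENNReal.ofReal (t * √(1 - t ^ 2) ^ m) * volume (ball (0 : E m) 1) ≤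
      volume (Prod.mk t ⁻¹' coneSector m h r) := by
    intro t ht
    have ht0 := h0.trans ht.1
    have hpos : 0 < 1 - t ^ 2 := by nlinarith [ht.1, ht.2]
    have hs : 0 < √(1 - t ^ 2) := Real.sqrt_pos.2 hpos
    -- The factor t ≤ 1 is given away so that the slice integral has an elementary antiderivative.
    have hle : t * √(1 - t ^ 2) ^ m ≤ √(1 - t ^ 2) ^ m :=
      mul_le_of_le_one_left (by positivity) ht.2.le
    refine (mul_le_mul_left (ENNReal.ofReal_le_ofReal hle) _).trans ?_
    rw [← hball _ hs]
    refine measure_mono fun z hz => ?_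
    rw [mem_ball_zero_iff] at hz
    have hz2 : ‖z‖ ^ 2 < 1 - t ^ 2 := by
      rw [← Real.sq_sqrt hpos.le]
      exact pow_lt_pow_left₀ hz (norm_nonneg z) two_ne_zero
    have hz3 : ‖z‖ < r := by
      refine lt_of_pow_lt_pow_left₀ 2 hr.le ?_
      nlinarith [ht.1]
    refine ⟨ht0, ?_, ?_⟩
    · dsimp only
      nlinarith [ht.1]
    · dsimp only
      linarith
  have hcont1 : Continuous fun t : ℝ => (r * t / h) ^ m := by fun_prop
  have hcont2 : Continuous fun t : ℝ => t * √(1 - t ^ 2) ^ m := by fun_prop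
  have e1 : ∫⁻ t in Ioo 0 h, ENNReal.ofReal ((r * t / h) ^ m) =
      ENNReal.ofReal (r ^ m * (h / (m + 1))) := by
    rw [← integral_mul_div_pow m h0, intervalIntegral.integral_of_le h0.le,
      integral_Ioc_eq_integral_Ioo, ofReal_integral_eq_lintegral_ofReal]
    · exact (hcont1.integrableOn_Icc (a := 0) (b := h)).mono_set Ioo_subset_Icc_self
    · filter_upwards [ae_restrict_mem measurableSet_Ioo] with t ht
      have := ht.1
      positivity
  have e2 : ∫⁻ t in Ioo h 1, ENNReal.ofReal (t * √(1 - t ^ 2) ^ m) =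
      ENNReal.ofReal (r ^ (m + 2) / (m + 2)) := by
    rw [← integral_mul_sqrt_one_sub_sq_pow m h0 h1.le hr.le hhr,
      intervalIntegral.integral_of_le h1.le,
      integral_Ioc_eq_integral_Ioo, ofReal_integral_eq_lintegral_ofReal]
    · exact (hcont2.integrableOn_Icc (a := h) (b := 1)).mono_set Ioo_subset_Icc_self
    · filter_upwards [ae_restrict_mem measurableSet_Ioo] with t ht
      have := h0.trans ht.1
      positivity
  have hdisj : Disjoint (Ioo 0 h) (Ioo h 1) :=
    Set.disjoint_left.2 fun t ht ht' => lt_asymm ht.2 ht'.1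
  have hmeas := (isOpen_coneSector m h r).measurableSet
  calc ENNReal.ofReal (r ^ m * (h / (m + 1)) + r ^ (m + 2) / (m + 2)) * volume (ball (0 : E m) 1)
      = (∫⁻ t in Ioo 0 h, ENNReal.ofReal ((r * t / h) ^ m) * volume (ball (0 : E m) 1)) +
        ∫⁻ t in Ioo h 1, ENNReal.ofReal (t * √(1 - t ^ 2) ^ m) * volume (ball (0 : E m) 1) := by
        rw [lintegral_mul_const _ (by fun_prop), lintegral_mul_const _ (by fun_prop), e1, e2,
          ← add_mul, ENNReal.ofReal_add (by positivity) (by positivity)]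
    _ ≤ (∫⁻ t in Ioo 0 h, volume (Prod.mk t ⁻¹' coneSector m h r)) +
        ∫⁻ t in Ioo h 1, volume (Prod.mk t ⁻¹' coneSector m h r) :=
        add_le_add (setLIntegral_mono' measurableSet_Ioo hsl1)
          (setLIntegral_mono' measurableSet_Ioo hsl2)
    _ = ∫⁻ t in Ioo 0 h ∪ Ioo h 1, volume (Prod.mk t ⁻¹' coneSector m h r) :=
        (lintegral_union measurableSet_Ioo hdisj).symm
    _ ≤ ∫⁻ t, volume (Prod.mk t ⁻¹' coneSector m h r) := setLIntegral_le_lintegral _ _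
    _ = volume (coneSector m h r) := (Measure.prod_apply hmeas).symm

lemma exists_isometryEquiv_prod {m : ℕ} {c : E (m + 1)} (hc : ‖c‖ = 1) :
    ∃ φ : WithLp 2 (ℝ × E m) ≃ₗᵢ[ℝ] E (m + 1), φ (WithLp.toLp 2 (1, 0)) = c := by
  have hdim : Module.finrank ℝ (WithLp 2 (ℝ × E m)) = Module.finrank ℝ (E (m + 1)) := by
    rw [LinearEquiv.finrank_eq (WithLp.linearEquiv 2 ℝ (ℝ × E m))]
    simp [add_comm]
  let ψ : WithLp 2 (ℝ × E m) ≃ₗᵢ[ℝ] E (m + 1) :=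
    (stdOrthonormalBasis ℝ _).equiv (stdOrthonormalBasis ℝ _) (finCongr hdim)
  have h1 : ‖ψ (WithLp.toLp 2 (1, 0))‖ = ‖c‖ := by
    rw [ψ.norm_map, hc, WithLp.prod_norm_eq_of_L2]
    simp
  -- Any isometry will do, followed by the reflection that takes the image of the first axis to c.
  refine ⟨ψ.trans (Submodule.reflection (ℝ ∙ (ψ (WithLp.toLp 2 (1, 0)) - c))ᗮ), ?_⟩
  exact Submodule.reflection_sub h1

/-- The circular cone around `c` with `h ‖z‖ < r t`, cut by the open unit ball. -/
def sector {n : ℕ} (c : E n) (h r : ℝ) : Set (E n) :=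
  {y | 0 < inner ℝ c y ∧ h * ‖y - inner ℝ c y • c‖ < r * inner ℝ c y ∧ ‖y‖ < 1}

lemma volume_sector {m : ℕ} {c : E (m + 1)} (hc : ‖c‖ = 1) (h r : ℝ) :
    volume (sector c h r) = volume (coneSector m h r) := by
  obtain ⟨φ, hφ⟩ := exists_isometryEquiv_prod hc
  have hmp : MeasurePreserving (fun q : ℝ × E m => φ (WithLp.toLp 2 q)) :=
    φ.measurePreserving.comp (WithLp.volume_preserving_toLp ℝ (E m))
  have hmeas : MeasurableSet (sector c h r) := by
    simp only [sector, ofPred_and]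
    refine ((isOpen_lt ?_ ?_).inter ((isOpen_lt ?_ ?_).inter (isOpen_lt ?_ ?_))).measurableSet <;>
      fun_prop
  rw [← hmp.measure_preimage hmeas.nullMeasurableSet]
  congr 1
  ext ⟨t, z⟩
  have e1 : inner ℝ c (φ (WithLp.toLp 2 (t, z))) = t := by
    rw [← hφ, φ.inner_map_map]
    simp [WithLp.prod_inner_apply]
  have e2 : ‖φ (WithLp.toLp 2 (t, z)) - t • c‖ = ‖z‖ := by
    rw [← hφ, ← map_smul, ← map_sub, φ.norm_map, WithLp.prod_norm_eq_of_L2]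
    simp
  have e3 : ‖φ (WithLp.toLp 2 (t, z))‖ < 1 ↔ t ^ 2 + ‖z‖ ^ 2 < 1 := by
    rw [φ.norm_map, WithLp.prod_norm_eq_of_L2, Real.sqrt_lt' one_pos]
    simp
  simp only [sector, coneSector, mem_preimage, mem_ofPred_eq, e1, e2, e3]

end ConeVolume

/-! ### Ratio of unit ball volumes in consecutive dimensions. -/

section BallRatio

open MeasureTheory Metric

/-- Log-convexity of Γ at the midpoint of x and x + 1. -/
lemma sqrt_mul_Gamma_le {x : ℝ} (hx : 0 < x) :
    √x * Real.Gamma (x + 1 / 2) ≤ Real.Gamma (x + 1) := by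
  have h := Real.Gamma_mul_add_mul_le_rpow_Gamma_mul_rpow_Gamma (s := x) (t := x + 1)
    (a := 1 / 2) (b := 1 / 2) hx (by linarith) (by norm_num) (by norm_num) (by norm_num)
  have e : 1 / 2 * x + 1 / 2 * (x + 1) = x + 1 / 2 := by ring
  rw [e, ← Real.sqrt_eq_rpow, ← Real.sqrt_eq_rpow] at h
  have hG := Real.Gamma_pos_of_pos hx
  calc √x * Real.Gamma (x + 1 / 2) ≤ √x * (√(Real.Gamma x) * √(Real.Gamma (x + 1))) := by gcongr
    _ = √(x * Real.Gamma x) * √(Real.Gamma (x + 1)) := by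
      rw [Real.sqrt_mul hx.le]; ring
    _ = Real.Gamma (x + 1) := by
      rw [← Real.Gamma_add_one hx.ne', Real.mul_self_sqrt (Real.Gamma_pos_of_pos (by linarith)).le]

lemma volume_real_ball_one (k : ℕ) :
    volume.real (ball (0 : E k) 1) = √Real.pi ^ k / Real.Gamma (k / 2 + 1) := by
  rcases k.eq_zero_or_pos with rfl | hk
  · rw [Measure.real, volume_euclideanSpace_eq_dirac, Measure.dirac_apply' _ measurableSet_ball]
    simp
  · have : Nonempty (Fin k) := ⟨⟨0, hk⟩⟩
    rw [Measure.real, EuclideanSpace.volume_ball]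
    have : 0 < Real.Gamma ((k : ℝ) / 2 + 1) := Real.Gamma_pos_of_pos (by positivity)
    simp [this.le, Real.sqrt_nonneg, div_nonneg, pow_nonneg]

lemma volume_ball_succ_le (m : ℕ) :
    √((m + 1) / (2 * Real.pi)) * volume.real (ball (0 : E (m + 1)) 1) ≤
      volume.real (ball (0 : E m) 1) := by
  rw [volume_real_ball_one, volume_real_ball_one]
  have hx : (0 : ℝ) < (m + 1) / 2 := by positivity
  have h := sqrt_mul_Gamma_le hx
  have e : ((m : ℝ) + 1) / 2 + 1 / 2 = m / 2 + 1 := by ring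
  rw [e] at h
  push_cast
  have g1 : 0 < Real.Gamma ((m : ℝ) / 2 + 1) := Real.Gamma_pos_of_pos (by positivity)
  have g2 : 0 < Real.Gamma (((m : ℝ) + 1) / 2 + 1) := Real.Gamma_pos_of_pos (by positivity)
  have hp : 0 < √Real.pi := Real.sqrt_pos.2 Real.pi_pos
  have e2 : √(((m : ℝ) + 1) / (2 * Real.pi)) = √((m + 1) / 2) / √Real.pi := by
    rw [← Real.sqrt_div hx.le, div_div]
  rw [e2, div_mul_div_comm, div_le_div_iff₀ (by positivity) g1, pow_succ]
  calc √((m + 1) / 2) * (√Real.pi ^ m * √Real.pi) * Real.Gamma (m / 2 + 1)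
      = √Real.pi ^ m * √Real.pi * (√((m + 1) / 2) * Real.Gamma (m / 2 + 1)) := by ring
    _ ≤ √Real.pi ^ m * √Real.pi * Real.Gamma ((m + 1) / 2 + 1) := by gcongr
    _ = _ := by ring

end BallRatio

end Illumination

namespace Illumination

/-! ### A cap containing a set of unit vectors. -/

section Center

/-- A set of unit vectors of diameter `D < √2` lies in a half-space through a cap: the direction of
the point of its closed convex hull nearest to the origin. -/
lemma exists_center {n : ℕ} (hn : 1 ≤ n) {X : Set (E n)} {D : ℝ} (hX : ∀ u ∈ X, ‖u‖ = 1)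
    (hD : D ^ 2 < 2) (hXD : ∀ u ∈ X, ∀ v ∈ X, ‖u - v‖ ≤ D) :
    ∃ c : E n, ‖c‖ = 1 ∧ ∀ u ∈ X, √(1 - D ^ 2 / 2) ≤ inner ℝ c u := by
  rcases X.eq_empty_or_nonempty with rfl | hne
  · exact ⟨EuclideanSpace.single ⟨0, hn⟩ 1, by simp, by simp⟩
  have h1 : ∀ u ∈ X, ∀ v ∈ X, 1 - D ^ 2 / 2 ≤ inner ℝ u v := by
    intro u hu v hv
    have h := norm_sub_sq_real u v
    rw [hX u hu, hX v hv] at h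
    have := pow_le_pow_left₀ (norm_nonneg _) (hXD u hu v hv) 2
    linarith
  set K := closure (convexHull ℝ X) with hK
  -- A lower bound on inner products passes to the closed convex hull in one argument at a time;
  -- used twice, it reaches ‖c‖².
  have hhalf : ∀ v : E n, (∀ u ∈ X, 1 - D ^ 2 / 2 ≤ inner ℝ v u) →
      ∀ a ∈ K, 1 - D ^ 2 / 2 ≤ inner ℝ v a := by
    intro v hv a ha
    have hconv : Convex ℝ {a : E n | 1 - D ^ 2 / 2 ≤ inner ℝ v a} :=
      convex_halfSpace_ge (innerₛₗ ℝ v).isLinear _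
    have hclosed : IsClosed {a : E n | 1 - D ^ 2 / 2 ≤ inner ℝ v a} :=
      isClosed_le (by fun_prop) (by fun_prop)
    exact closure_minimal (convexHull_min hv hconv) hclosed ha
  have h2 : ∀ v ∈ X, ∀ a ∈ K, 1 - D ^ 2 / 2 ≤ inner ℝ v a := fun v hv =>
    hhalf v fun u hu => h1 v hv u hu
  have h3 : ∀ b ∈ K, ∀ a ∈ K, 1 - D ^ 2 / 2 ≤ inner ℝ b a := fun b hb =>
    hhalf b fun u hu => by
      rw [real_inner_comm]
      exact h2 u hu b hb
  have hconv : Convex ℝ K := (convex_convexHull ℝ X).closure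
  have hsub : X ⊆ K := (subset_convexHull ℝ X).trans subset_closure
  obtain ⟨c, hc, hmin⟩ := exists_norm_eq_iInf_of_complete_convex (hne.mono hsub)
    isClosed_closure.isComplete hconv 0
  rw [norm_eq_iInf_iff_real_inner_le_zero hconv hc] at hmin
  have h4 : 1 - D ^ 2 / 2 ≤ ‖c‖ ^ 2 := by
    rw [← real_inner_self_eq_norm_sq]
    exact h3 c hc c hc
  have hc0 : 0 < ‖c‖ := by
    by_contra! h
    have : ‖c‖ = 0 := le_antisymm h (norm_nonneg c)
    rw [this] at h4
    linarith
  refine ⟨‖c‖⁻¹ • c, by rw [norm_smul, norm_inv, norm_norm, inv_mul_cancel₀ hc0.ne'], ?_⟩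
  intro u hu
  have h5 := hmin u (hsub hu)
  -- The nearest-point inequality becomes ‖c‖² ≤ ⟨c, u⟩.
  rw [zero_sub, inner_neg_left, inner_sub_right, real_inner_self_eq_norm_sq] at h5
  rw [real_inner_smul_left, inv_mul_eq_div, le_div_iff₀ hc0]
  have h6 : √(1 - D ^ 2 / 2) ≤ ‖c‖ := Real.sqrt_le_iff.2 ⟨hc0.le, h4⟩
  nlinarith

end Center

/-! ### The polar fills half of a circular cone. -/

section Polar

open MeasureTheory Metric

/-- The directions that make an acute angle with every element of `X`, uniformly. -/
def strictPolar {n : ℕ} (X : Set (E n)) : Set (E n) :=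
  {y | ∃ ε : ℝ, 0 < ε ∧ ∀ u ∈ X, ε ≤ inner ℝ u y}

/-- The uniform ε makes this a countable union of closed sets, even for uncountable X. -/
lemma measurableSet_strictPolar {n : ℕ} (X : Set (E n)) : MeasurableSet (strictPolar X) := by
  have : strictPolar X = ⋃ k : ℕ, ⋂ u ∈ X, {y : E n | 1 / ((k : ℝ) + 1) ≤ inner ℝ u y} := by
    ext y
    simp only [strictPolar, Set.mem_ofPred_eq, Set.mem_iUnion, Set.mem_iInter]
    constructor
    · rintro ⟨ε, hε, h⟩
      obtain ⟨k, hk⟩ := exists_nat_one_div_lt hε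
      exact ⟨k, fun u hu => hk.le.trans (h u hu)⟩
    · rintro ⟨k, h⟩
      exact ⟨_, by positivity, h⟩
  rw [this]
  exact MeasurableSet.iUnion fun k => (isClosed_biInter fun u _ =>
    isClosed_le (by fun_prop) (by fun_prop)).measurableSet

/-- If `y` is in a suitable circular cone around the centre of `X`, then `y` or its mirror image in
the axis of the cone is in the polar of `X`. -/
lemma mem_strictPolar_or_reflection_mem {n : ℕ} {X : Set (E n)} {c : E n} {D a h r : ℝ}
    (hD : 0 < D) (hh : 0 < h) (hXD : ∀ u ∈ X, ∀ v ∈ X, ‖u - v‖ ≤ D) (hc : ‖c‖ = 1)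
    (ha : ∀ u ∈ X, a ≤ inner ℝ c u)
    (hrD : r * D ≤ 2 * a * h) {y : E n} (hy : y ∈ sector c h r) :
    y ∈ strictPolar X ∨ Submodule.reflection (ℝ ∙ c) y ∈ strictPolar X := by
  obtain ⟨ht, hz, -⟩ := hy
  set t := inner ℝ c y with ht_def
  set z := y - t • c with hz_def
  have hyz : y = t • c + z := by rw [hz_def]; abel
  have hσ : Submodule.reflection (ℝ ∙ c) y = t • c - z := by
    rw [Submodule.reflection_apply, Submodule.starProjection_unit_singleton ℝ hc, hz_def, two_smul]
    abel
  -- Chain: 2tah ≥ trD > hD‖z‖.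
  have hpos : 0 < h * (2 * t * a - D * ‖z‖) := by nlinarith
  have hε : 0 < (2 * t * a - D * ‖z‖) / 2 := half_pos (pos_of_mul_pos_right hpos hh.le)
  by_contra! hcon
  obtain ⟨h1, h2⟩ := hcon
  simp only [strictPolar, Set.mem_ofPred_eq, not_exists, not_and, not_forall, not_le] at h1 h2
  -- Let u defeat y and v defeat its mirror image. Adding gives t⟨c, u + v⟩ + ⟨z, u - v⟩ < 2ε, yet
  -- the left side is at least 2ta - D‖z‖ = 2ε.
  obtain ⟨u, hu, hu1⟩ := h1 _ hε
  obtain ⟨v, hv, hv1⟩ := h2 _ hε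
  rw [hyz, inner_add_right, real_inner_smul_right, real_inner_comm] at hu1
  rw [hσ, inner_sub_right, real_inner_smul_right, real_inner_comm] at hv1
  have h3 : inner ℝ (v - u) z ≤ D * ‖z‖ :=
    (real_inner_le_norm _ _).trans (mul_le_mul_of_nonneg_right (hXD v hv u hu) (norm_nonneg z))
  rw [inner_sub_left] at h3
  have h4 := mul_le_mul_of_nonneg_left (ha u hu) ht.le
  have h5 := mul_le_mul_of_nonneg_left (ha v hv) ht.le
  linarith

lemma volume_sector_le {n : ℕ} {X : Set (E n)} {c : E n} {D a h r : ℝ}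
    (hD : 0 < D) (hh : 0 < h) (hXD : ∀ u ∈ X, ∀ v ∈ X, ‖u - v‖ ≤ D) (hc : ‖c‖ = 1)
    (ha : ∀ u ∈ X, a ≤ inner ℝ c u) (hrD : r * D ≤ 2 * a * h) :
    volume (sector c h r) ≤ 2 * volume (ball (0 : E n) 1 ∩ strictPolar X) := by
  set σ := Submodule.reflection (ℝ ∙ c)
  have hsub : sector c h r ⊆ (ball (0 : E n) 1 ∩ strictPolar X) ∪
      σ ⁻¹' (ball (0 : E n) 1 ∩ strictPolar X) := by
    intro y hy
    have hy1 : ‖y‖ < 1 := hy.2.2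
    rcases mem_strictPolar_or_reflection_mem hD hh hXD hc ha hrD hy with h | h
    · exact Or.inl ⟨mem_ball_zero_iff.2 hy1, h⟩
    · exact Or.inr ⟨mem_ball_zero_iff.2 (by rwa [σ.norm_map]), h⟩
  have hm : MeasurableSet (ball (0 : E n) 1 ∩ strictPolar X) :=
    measurableSet_ball.inter (measurableSet_strictPolar X)
  calc volume (sector c h r) ≤ _ := measure_mono hsub
    _ ≤ _ := measure_union_le _ _
    _ = 2 * volume (ball (0 : E n) 1 ∩ strictPolar X) := by
      rw [σ.measurePreserving.measure_preimage hm.nullMeasurableSet, two_mul]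

/-- The uniform probability measure on the unit ball. -/
noncomputable def ballMeasure (n : ℕ) : Measure (E n) := ProbabilityTheory.cond volume (ball (0 : E n) 1)

instance (n : ℕ) : IsProbabilityMeasure (ballMeasure n) :=
  ProbabilityTheory.cond_isProbabilityMeasure_of_finite (measure_ball_pos _ _ one_pos).ne'
    measure_ball_lt_top.ne

lemma le_ballMeasure_strictPolar {m : ℕ} {X : Set (E (m + 1))} {D h r : ℝ}
    (hX : ∀ u ∈ X, ‖u‖ = 1) (hD0 : 0 < D) (hD : D ^ 2 < 2)
    (hXD : ∀ u ∈ X, ∀ v ∈ X, ‖u - v‖ ≤ D) (h0 : 0 < h) (hr : 0 < r) (hhr : h ^ 2 + r ^ 2 = 1)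
    (hrD : r * D ≤ 2 * √(1 - D ^ 2 / 2) * h) :
    √((m + 1) / (2 * Real.pi)) * (r ^ m * (h / (m + 1)) + r ^ (m + 2) / (m + 2)) / 2 ≤
      (ballMeasure (m + 1)).real (strictPolar X) := by
  obtain ⟨c, hc, hcX⟩ := exists_center (Nat.le_add_left 1 m) hX hD hXD
  have h1 := volume_sector_le hD0 h0 hXD hc hcX hrD
  rw [volume_sector hc] at h1
  have h2 := (le_volume_coneSector m h0 hr hhr).trans h1
  set V := r ^ m * (h / (m + 1)) + r ^ (m + 2) / (m + 2) with hV
  have hV0 : 0 ≤ V := by positivity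
  have hfin : volume (ball (0 : E (m + 1)) 1 ∩ strictPolar X) ≠ ⊤ :=
    ((measure_mono Set.inter_subset_left).trans_lt measure_ball_lt_top).ne
  have h3 := ENNReal.toReal_mono (ENNReal.mul_ne_top ENNReal.ofNat_ne_top hfin) h2
  rw [ENNReal.toReal_mul, ENNReal.toReal_mul, ENNReal.toReal_ofReal hV0, ENNReal.toReal_ofNat] at h3
  change V * volume.real (ball (0 : E m) 1) ≤
    2 * volume.real (ball (0 : E (m + 1)) 1 ∩ strictPolar X) at h3
  have hB : 0 < volume.real (ball (0 : E (m + 1)) 1) :=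
    ENNReal.toReal_pos (measure_ball_pos _ _ one_pos).ne' measure_ball_lt_top.ne
  have h4 := mul_le_mul_of_nonneg_left (volume_ball_succ_le m) hV0
  rw [ballMeasure, Measure.real, ProbabilityTheory.cond_apply measurableSet_ball,
    ENNReal.toReal_mul, ENNReal.toReal_inv, inv_mul_eq_div]
  change _ ≤ volume.real (ball (0 : E (m + 1)) 1 ∩ strictPolar X) / volume.real (ball (0 : E (m + 1)) 1)
  rw [le_div_iff₀ hB]
  linarith

end Polar

end Illumination

namespace Illumination

/-! ### Numerical estimates. -/

section Estimate

/-- The cone parameters that suit diameter `1 + 2 / (25 n)`. -/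
lemma exists_cone_parameters {x : ℝ} (hx0 : 0 < x) (hx1 : x ≤ 1) :
    ∃ h : ℝ, 577 / 1000 ≤ h ∧ h ^ 2 + (√(2 / 3) * (1 - 13 / 200 * x)) ^ 2 = 1 ∧
      √(2 / 3) * (1 - 13 / 200 * x) * (1 + 2 / 25 * x) ≤
        2 * √(1 - (1 + 2 / 25 * x) ^ 2 / 2) * h := by
  have hs : √(2 / 3 : ℝ) ^ 2 = 2 / 3 := Real.sq_sqrt (by norm_num)
  have e : (√(2 / 3) * (1 - 13 / 200 * x)) ^ 2 = 2 / 3 * (1 - 13 / 200 * x) ^ 2 := by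
    rw [mul_pow, hs]
  have h1 : 1 / 3 ≤ 1 - 2 / 3 * (1 - 13 / 200 * x) ^ 2 := by nlinarith
  have hD : 0 ≤ 1 - (1 + 2 / 25 * x) ^ 2 / 2 := by nlinarith
  refine ⟨√(1 - 2 / 3 * (1 - 13 / 200 * x) ^ 2), ?_, ?_, ?_⟩
  · refine Real.le_sqrt_of_sq_le ?_
    linarith
  · rw [Real.sq_sqrt (by linarith), e]
    ring
  -- The squared inequality is an equality at x = 0; to first order in x it needs a slope of at
  -- least 4/75, which 13/200 exceeds.
  · refine le_of_sq_le_sq ?_ (by positivity)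
    rw [mul_pow, e, mul_pow, mul_pow, Real.sq_sqrt hD, Real.sq_sqrt (by linarith)]
    nlinarith [pow_pos hx0 2, pow_pos hx0 3, mul_nonneg hx0.le (sub_nonneg.2 hx1),
      mul_nonneg (pow_pos hx0 2).le (sub_nonneg.2 hx1),
      mul_nonneg (pow_pos hx0 3).le (sub_nonneg.2 hx1)]

lemma measure_estimate (m : ℕ) {h : ℝ} (hh : 577 / 1000 ≤ h) :
    4 / 19 * √(2 / 3) ^ (m + 1) / √(m + 1) ≤
      √((m + 1) / (2 * Real.pi)) *
        ((√(2 / 3) * (1 - 13 / 200 * (1 / (m + 1)))) ^ m * (h / (m + 1)) +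
        (√(2 / 3) * (1 - 13 / 200 * (1 / (m + 1)))) ^ (m + 2) / (m + 2)) / 2 := by
  set n : ℝ := (m : ℝ) + 1 with hn
  have hm0 : (0 : ℝ) ≤ m := Nat.cast_nonneg m
  have hn1 : 1 ≤ n := by linarith
  have hn0 : 0 < n := by linarith
  set q : ℝ := √(2 / 3) with hq
  have hq0 : 0 < q := Real.sqrt_pos.2 (by norm_num)
  have hq2 : q ^ 2 = 2 / 3 := Real.sq_sqrt (by norm_num)
  set y : ℝ := 13 / 200 * (1 / n) with hy
  have hy1 : y ≤ 13 / 200 := by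
    rw [hy]
    have : 1 / n ≤ 1 := by rw [div_le_one hn0]; exact hn1
    linarith
  have hyn : y * n = 13 / 200 := by rw [hy]; field_simp
  have b1 : 1 - m * y ≤ (1 - y) ^ m := by
    have := one_add_mul_le_pow (a := -y) (by linarith) m
    calc 1 - m * y = 1 + m * -y := by ring
      _ ≤ _ := this
      _ = _ := by ring
  have b2 : 1 - (m + 2) * y ≤ (1 - y) ^ (m + 2) := by
    have := one_add_mul_le_pow (a := -y) (by linarith) (m + 2)
    push_cast at this
    calc 1 - (m + 2) * y = 1 + ((m : ℝ) + 2) * -y := by ring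
      _ ≤ _ := this
      _ = _ := by ring
  have e1 : (m : ℝ) + 2 = n + 1 := by rw [hn]; ring
  have e2 : (m : ℝ) * y = 13 / 200 - y := by
    rw [show (m : ℝ) = n - 1 by rw [hn]; ring, sub_mul, one_mul, mul_comm, mul_comm n y] at *
    linarith
  have e3 : ((m : ℝ) + 2) * y = 13 / 200 + y := by linarith
  -- The tight case is n = 1, where the lower bounds below total about 0.867.
  have hbr : 866 / 1000 ≤ n * ((1 - y) ^ m * (h / n) + 2 / 3 * (1 - y) ^ (m + 2) / (n + 1)) := by
    have c1 : 577 / 1000 * (187 / 200 + y) ≤ h * (1 - y) ^ m := by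
      have : 0 ≤ 1 - m * y := by rw [e2]; linarith [show 0 ≤ y by positivity]
      calc 577 / 1000 * (187 / 200 + y) = 577 / 1000 * (1 - m * y) := by rw [e2]; ring
        _ ≤ _ := by gcongr
    have c2 : 187 / 200 - y ≤ (1 - y) ^ (m + 2) := by linarith
    have e4 : n * ((1 - y) ^ m * (h / n) + 2 / 3 * (1 - y) ^ (m + 2) / (n + 1)) =
        h * (1 - y) ^ m + 2 / 3 * (1 - y) ^ (m + 2) * (n / (n + 1)) := by
      field_simp
    have c3 : 2 / 3 * (187 / 200 - y) * (n / (n + 1)) ≤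
        2 / 3 * (1 - y) ^ (m + 2) * (n / (n + 1)) := by gcongr
    have c4 : 866 / 1000 ≤ 577 / 1000 * (187 / 200 + y) + 2 / 3 * (187 / 200 - y) * (n / (n + 1)) := by
      have : 2 / 3 * (187 / 200 - y) * (n / (n + 1)) =
          2 / 3 * (187 / 200 * n - 13 / 200) / (n + 1) := by
        rw [← hyn]; ring
      rw [this, hy]
      rw [← sub_nonneg]
      have : 577 / 1000 * (187 / 200 + 13 / 200 * (1 / n)) +
          2 / 3 * (187 / 200 * n - 13 / 200) / (n + 1) - 866 / 1000 =
          ((577 / 1000 * (187 / 200 * n + 13 / 200)) * (n + 1) +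
            2 / 3 * (187 / 200 * n - 13 / 200) * n - 866 / 1000 * n * (n + 1)) / (n * (n + 1)) := by
        field_simp
      rw [this]
      refine div_nonneg ?_ (by positivity)
      nlinarith
    linarith
  have hpi := Real.pi_lt_d4
  have hpi0 := Real.pi_pos
  have hsn : √n * √n = n := Real.mul_self_sqrt hn0.le
  have hsn0 : 0 < √n := Real.sqrt_pos.2 hn0
  set g : ℝ := √(1 / (2 * Real.pi)) with hg
  have eg : √(n / (2 * Real.pi)) = √n * g := by
    rw [hg, ← Real.sqrt_mul hn0.le]; ring_nf
  -- 2442/5000 is just below √(3/(4π)); half its product with 866/1000 is just above 4/19.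
  have hgq : 2442 / 5000 * q ≤ g := by
    refine Real.le_sqrt_of_sq_le ?_
    rw [mul_pow, hq2, le_div_iff₀ (by positivity)]
    nlinarith
  rw [eg, e1, mul_pow, mul_pow, div_le_iff₀ hsn0]
  have e5 : √n * g * (q ^ m * (1 - y) ^ m * (h / n) + q ^ (m + 2) * (1 - y) ^ (m + 2) / (n + 1)) / 2
      * √n = q ^ m / 2 * g *
        (n * ((1 - y) ^ m * (h / n) + 2 / 3 * (1 - y) ^ (m + 2) / (n + 1))) := by
    rw [pow_add q m 2, hq2]
    linear_combination (g * (q ^ m * (1 - y) ^ m * (h / n) +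
      q ^ m * (2 / 3) * (1 - y) ^ (m + 2) / (n + 1)) / 2) * hsn
  rw [e5]
  calc 4 / 19 * q ^ (m + 1) ≤ q ^ m / 2 * (2442 / 5000 * q) * (866 / 1000) := by
        rw [pow_succ]
        nlinarith [pow_pos hq0 m, mul_pos (pow_pos hq0 m) hq0]
    _ ≤ _ := by gcongr

lemma net_estimate {n : ℕ} (hn : 1 ≤ n) :
    (1 + 50 * (n : ℝ)) ^ n ≤ Real.exp (n * (4 + Real.log n)) := by
  have hn' : (1 : ℝ) ≤ n := by exact_mod_cast hn
  have he : (51 : ℝ) ≤ Real.exp 4 := by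
    have h := Real.exp_one_gt_d9
    have h4 : Real.exp 4 = Real.exp 1 ^ 4 := by rw [← Real.exp_nat_mul]; norm_num
    rw [h4]
    calc (51 : ℝ) ≤ 2.7182818283 ^ 4 := by norm_num
      _ ≤ _ := by gcongr
  rw [Real.exp_nat_mul, Real.exp_add, Real.exp_log (by linarith)]
  gcongr
  nlinarith

lemma final_estimate {n : ℕ} (hn : 1 ≤ n) {p : ℝ} (hp : p = 4 / 19 * √(2 / 3) ^ n / √n) :
    n * (4 + Real.log n) / p + 1 ≤
      5 * (n : ℝ) * √(n : ℝ) * (4 + Real.log (n : ℝ)) * (3 / 2 : ℝ) ^ ((n : ℝ) / 2) := by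
  have hn' : (1 : ℝ) ≤ n := by exact_mod_cast hn
  have hq0 : 0 < √(2 / 3 : ℝ) := Real.sqrt_pos.2 (by norm_num)
  have e1 : (3 / 2 : ℝ) ^ ((n : ℝ) / 2) = (√(2 / 3) ^ n)⁻¹ := by
    rw [← inv_pow, ← Real.sqrt_inv, Real.sqrt_eq_rpow, ← Real.rpow_natCast,
      ← Real.rpow_mul (by norm_num)]
    norm_num
    ring_nf
  have hQ1 : 1 ≤ (√(2 / 3 : ℝ) ^ n)⁻¹ := by
    refine (one_le_inv₀ (by positivity)).2 (pow_le_one₀ hq0.le ?_)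
    exact Real.sqrt_le_one.2 (by norm_num)
  have hs1 : 1 ≤ √(n : ℝ) := Real.one_le_sqrt.2 hn'
  have hL : 4 ≤ 4 + Real.log n := by linarith [Real.log_nonneg hn']
  have e2 : n * (4 + Real.log n) / p =
      19 / 4 * ((n : ℝ) * √(n : ℝ) * (4 + Real.log n) * (√(2 / 3) ^ n)⁻¹) := by
    rw [hp]
    field_simp
  -- The first term costs 19/4 of this product; the remaining quarter is at least 1 and pays for the
  -- +1.
  have h4 : 4 ≤ (n : ℝ) * √(n : ℝ) * (4 + Real.log n) * (√(2 / 3) ^ n)⁻¹ :=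
    calc (4 : ℝ) = 1 * 1 * 4 * 1 := by norm_num
      _ ≤ _ := by gcongr
  rw [e1, e2]
  linarith

end Estimate

end Illumination

namespace Illumination

/-! ### Illuminating a body of constant width. -/

section Main

variable {n : ℕ} {W : Set (E n)}

/-- The far ends x₁ - w u₁ and x₂ - w u₂ of the diameters lie in W, hence within w of each other,
while x₁ and x₂ are within 2wδ. -/
lemma norm_sub_le_of_mem_outerNormals (hW : IsConvexBody W) {w δ : ℝ}
    (hw : ∀ u : E n, ‖u‖ = 1 → width W u = w) (hw0 : 0 < w) {s x₁ x₂ u₁ u₂ : E n}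
    (hx₁ : x₁ ∈ W) (hx₂ : x₂ ∈ W) (h₁ : dist x₁ s ≤ w * δ) (h₂ : dist x₂ s ≤ w * δ)
    (hu₁ : u₁ ∈ outerNormals W x₁) (hu₂ : u₂ ∈ outerNormals W x₂) :
    ‖u₁ - u₂‖ ≤ 1 + 2 * δ := by
  have hz₁ := sub_smul_mem_of_mem_outerNormals hW hw hw0 hx₁ hu₁
  have hz₂ := sub_smul_mem_of_mem_outerNormals hW hw hw0 hx₂ hu₂
  have hz : ‖(x₁ - w • u₁) - (x₂ - w • u₂)‖ ≤ w := by
    by_cases h : x₁ - w • u₁ = x₂ - w • u₂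
    · rw [h, sub_self, norm_zero]
      exact hw0.le
    · exact norm_sub_le_of_width hW hw hz₁ hz₂ h
  have hx : ‖x₁ - x₂‖ ≤ w * δ + w * δ := by
    rw [← dist_eq_norm]
    exact (dist_triangle_right x₁ x₂ s).trans (add_le_add h₁ h₂)
  have e : w • (u₁ - u₂) = (x₁ - x₂) - ((x₁ - w • u₁) - (x₂ - w • u₂)) := by
    rw [smul_sub]; abel
  have h : w * ‖u₁ - u₂‖ ≤ w * (1 + 2 * δ) := by
    rw [← Real.norm_of_nonneg hw0.le, ← norm_smul, e, Real.norm_of_nonneg hw0.le]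
    refine (norm_sub_le _ _).trans ?_
    linarith
  exact le_of_mul_le_mul_left h hw0

/-- Few directions illuminate a body of constant width. -/
lemma exists_illuminating_directions (hn : 1 ≤ n) (hW : IsConstantWidth W) :
    ∃ Y : Finset (E n), (∀ x ∈ W, ∃ y ∈ Y, ∀ u ∈ outerNormals W x, inner ℝ u y < 0) ∧
      (Y.card : ℝ) ≤ 5 * (n : ℝ) * √(n : ℝ) * (4 + Real.log (n : ℝ)) *
        (3 / 2 : ℝ) ^ ((n : ℝ) / 2) := by
  classical
  obtain ⟨hb, w, hw⟩ := hW
  have hw0 : 0 < w := width_pos hn hb hw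
  obtain ⟨x₀, hx₀⟩ := hb.nonempty
  obtain ⟨m, rfl⟩ : ∃ m, n = m + 1 := ⟨n - 1, by omega⟩
  have hx0 : 0 < 1 / ((m : ℝ) + 1) := by positivity
  have hx1 : 1 / ((m : ℝ) + 1) ≤ 1 := by
    rw [div_le_one (by positivity)]
    linarith [(Nat.cast_nonneg m : (0 : ℝ) ≤ m)]
  set x := 1 / ((m : ℝ) + 1) with hx
  have hsub : W ⊆ Metric.closedBall x₀ w := by
    intro a ha
    rw [Metric.mem_closedBall, dist_eq_norm]
    by_cases h : a = x₀
    · rw [h, sub_self, norm_zero]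
      exact hw0.le
    · exact norm_sub_le_of_width hb hw ha hx₀ h
  obtain ⟨S, hS, hScard⟩ := exists_net x₀ (r := w * (x / 25)) (by positivity) hw0.le hsub
  have hScard' : (S.card : ℝ) ≤
      Real.exp ((m + 1 : ℕ) * (4 + Real.log (m + 1 : ℕ))) := by
    refine hScard.trans (le_trans (le_of_eq ?_) (net_estimate hn))
    congr 1
    rw [hx]
    push_cast
    field_simp
    ring
  let X : E (m + 1) → Set (E (m + 1)) := fun s =>
    {u | ∃ a ∈ W, dist a s ≤ w * (x / 25) ∧ u ∈ outerNormals W a}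
  have hX1 : ∀ s, ∀ u ∈ X s, ‖u‖ = 1 := by
    rintro s u ⟨a, -, -, hu⟩
    exact hu.1
  have hXD : ∀ s, ∀ u ∈ X s, ∀ v ∈ X s, ‖u - v‖ ≤ 1 + 2 / 25 * x := by
    rintro s u ⟨a, ha, has, hu⟩ v ⟨b, hb', hbs, hv⟩
    have := norm_sub_le_of_mem_outerNormals hb hw hw0 ha hb' has hbs hu hv
    linarith
  obtain ⟨h, hh, hhr, hrD⟩ := exists_cone_parameters hx0 hx1
  set p : ℝ := 4 / 19 * √(2 / 3) ^ (m + 1) / √(m + 1 : ℕ) with hp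
  have hq0 : 0 < √(2 / 3 : ℝ) := Real.sqrt_pos.2 (by norm_num)
  have hr0 : 0 < √(2 / 3) * (1 - 13 / 200 * x) := mul_pos hq0 (by linarith)
  have hpX : ∀ s, p ≤ (ballMeasure (m + 1)).real (strictPolar (X s)) := fun s => by
    rw [hp]
    push_cast
    exact (measure_estimate m hh).trans (le_ballMeasure_strictPolar (hX1 s) (by positivity)
      (by nlinarith) (hXD s) (by linarith) hr0 hhr hrD)
  have hL : 0 ≤ ((m + 1 : ℕ) : ℝ) * (4 + Real.log (m + 1 : ℕ)) := by
    have := Real.log_natCast_nonneg (m + 1)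
    positivity
  obtain ⟨Y, hYcard, hY⟩ := exists_hitting (ballMeasure (m + 1))
    (fun s => measurableSet_strictPolar (X s)) hpX (by positivity)
    -- Any centre, here 0, shows p ≤ 1.
    ((hpX 0).trans MeasureTheory.measureReal_le_one) S hL hScard'
  refine ⟨Y.image fun y => -y, ?_, ?_⟩
  · intro a ha
    obtain ⟨s, hs, has⟩ := hS a ha
    obtain ⟨y, hy, ε, hε, hyε⟩ := hY s hs
    -- Points of the polar have positive products with the normals, so their negatives illuminate.
    refine ⟨-y, Finset.mem_image_of_mem _ hy, fun u hu => ?_⟩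
    rw [inner_neg_right]
    linarith [hyε u ⟨a, ha, has, hu⟩]
  · calc ((Y.image fun y => -y).card : ℝ) ≤ Y.card := by exact_mod_cast Finset.card_image_le
      _ ≤ _ := hYcard
      _ ≤ _ := final_estimate hn hp

end Main

end Illumination

theorem mainTheorem6 (n : ℕ) (hn : 1 ≤ n) (W : Set (Illumination.E n))
    (hW : Illumination.IsConstantWidth W) :
    ∃ N : ℕ, Illumination.illuminationNumber W = (N : ℕ∞) ∧
      (N : ℝ) ≤ 5 * (n : ℝ) * Real.sqrt (n : ℝ) * (4 + Real.log (n : ℝ)) *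
        (3 / 2 : ℝ) ^ ((n : ℝ) / 2) := by
  obtain ⟨Y, hY, hcard⟩ := Illumination.exists_illuminating_directions hn hW
  have h := Illumination.illuminationNumber_le_card hW.isConvexBody Y hY
  obtain ⟨N, hN⟩ := ENat.ne_top_iff_exists.1 (h.trans_lt (ENat.natCast_lt_top _)).ne
  refine ⟨N, hN.symm, le_trans ?_ hcard⟩
  rw [← hN] at h
  exact_mod_cast h
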